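/- Let $\mathbb F$ be an arbitrary field. A matrix polynomial $Q(\lambda)\in\mathbb F[\lambda]^{a\times b}$ has grade $k$ if $Q(\lambda)=\sum_{i=0}^kQ_i\lambda^i$ with $Q_i\in\mathbb F^{a\times b}$ ($Q_k=0$ is allowed); $\mathbb F_k[\lambda]^{a\times b}$ denotes the space of these. $Q(\lambda)$ is a minimal basis if its rows are linearly independent over $\mathbb F(\lambda)$ and the sum of the degrees of its rows is least among all polynomial bases of the rational subspace that they span. $K(\lambda)\in\mathbb F[\lambda]^{a\times (a+b)}$ and $N(\lambda)\in\mathbb F[\lambda]^{b\times(a+b)}$ are dual minimal bases if both are minimal bases and $K(\lambda)N(\lambda)^T=0$ (the border cases $a=0$ or $b=0$ are allowed). For $Q(\lambda)$ of grade $q$ the convolution matrix $C_j(Q)$ is the block matrix with $q+j+1$ block rows and $j+1$ block columns, indexed from $0$, whose $(r,s)$ block is $Q_{q-(r-s)}$ if $0\le r-s\le q$ and $0$ otherwise; $C_0(Q)$ is thus the block column of $Q_q,\dots,Q_0$. Given an involution of $\mathbb F$ (a field automorphism $x\mapsto \bar x$ with $\bar{\bar x}=x$, possibly the identity), a Moore--Penrose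 inverse of a matrix $A$ over $\mathbb F$ is a matrix $G$ with $AGA=A$, $GAG=G$, $(AG)^*=AG$, $(GA)^*=GA$, where $*$ is the conjugate transpose; it is unique if it exists and is denoted by $A^\dagger$. For $N(\lambda)$ of grade $g$ such that $C_b(N)^\dagger$ exists, and $Q(\lambda)$ of grade $g+b$ with as many rows as $N(\lambda)$, let $\Phi_{N,b}^\dagger[Q]$ (the minimum norm solution of $N(\lambda)B(\lambda)=Q(\lambda)$) be the matrix polynomial $B(\lambda)$ of grade $b$ with $C_0(B)=C_b(N)^\dagger C_0(Q)$. **Theorem.** Let $m,n\ge 1$, $0\le \ell<d$, and let $P(\lambda)\in\mathbb F[\lambda]^{m\times n}$ be of grade $d$. Let $K_1(\lambda)\in\mathbb F[\lambda]^{m_1\times(n+m_1)}$ and $N_1(\lambda)\in\mathbb F[\lambda]^{n\times (n+m_1)}$, and $K_2(\lambda)\in\mathbb F[\lambda]^{m_2\times(m+m_2)}$ and $N_2(\lambda)\in\mathbb F[\lambda]^{m\times (m+m_2)}$, be two pairs of dual minimal bases such that all row degrees of $K_1(\lambda)$ and of $K_2(\lambda)$ are equal to $\ell$, all row degrees of $N_1(\lambda)$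 are equal to $\epsilon$, and all row degrees of $N_2(\lambda)$ are equal to $\eta$, with $\epsilon+\eta=d-\ell$. Consider the equation $$N_2(\lambda)M(\lambda)N_1(\lambda)^T=P(\lambda)\qquad(1)$$ for the unknown $M(\lambda)\in\mathbb F_\ell[\lambda]^{(m+m_2)\times(n+m_1)}$. (a) Equation (1) has a solution of grade $\ell$, and infinitely many of them if $\mathbb F$ is infinite. When $\deg P(\lambda)=d$, every solution of grade $\ell$ has degree exactly $\ell$. (b) The set of solutions of grade $\ell$ depends on $m_2n(\epsilon+1)+(m_2+m)m_1$ free parameters, that is, it is an affine space over $\mathbb F$ of this dimension. (c) Let an involution of $\mathbb F$ be given. If it is anisotropic, i.e. $\sum_i\bar v_iv_i=0$ with $v\in\mathbb F^k$ only for $v=0$ (as is the case over $\mathbb R$ with the identity and over $\mathbb C$ with complex conjugation), then the Moore--Penrose inverses of $C_\ell(N_1)$ and $C_{\ell+\epsilon}(N_2)$ exist ($N_1(\lambda)$ and $N_2(\lambda)$ being taken with grades $\epsilon$ and $\eta$). Whenever these two Moore--Penrose inverses exist, put $\Phi_1^\dagger=\Phi_{N_1,\ell}^\dagger$, $\Phi_2^\dagger=\Phi_{N_2,\ell+\epsilon}^\dagger$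 and $\Psi^\dagger[P]=\bigl(\Phi_1^\dagger\bigl[(\Phi_2^\dagger[P])^T\bigr]\bigr)^T$. Then the solutions of (1) of grade $\ell$ are exactly the matrix polynomials $$M(\lambda)=\Psi^\dagger[P](\lambda)+\Phi_1^\dagger[X^TK_2](\lambda)^T+Y^TK_1(\lambda),\qquad X(\lambda)\in\mathbb F_\epsilon[\lambda]^{m_2\times n},\ Y\in\mathbb F^{m_1\times(m_2+m)},$$ and each solution arises from exactly one pair $(X(\lambda),Y)$. -/

import Mathlib

open scoped Polynomial Matrix

/-! ## Matrix polynomials: grade and degree -/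

/-- `P` has grade `k`: it can be written as `∑_{i ≤ k} P_i λ^i` (the coefficient `P_k` may be
zero). -/
def HasGrade {F : Type*} [Field F] {a b : ℕ} (P : Matrix (Fin a) (Fin b) F[X]) (k : ℕ) : Prop :=
  ∀ i j, (P i j).degree ≤ (k : WithBot ℕ)

/-- The degree of a matrix polynomial, with `⊥` as the degree of the zero matrix. -/
noncomputable def matDegree {F : Type*} [Field F] {a b : ℕ} (P : Matrix (Fin a) (Fin b) F[X]) :
    WithBot ℕ :=
  Finset.univ.sup fun p : Fin a × Fin b => (P p.1 p.2).degree

/-- The degree of the `i`-th row. (Rows of polynomial bases are nonzero; the value at a zero row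
is irrelevant.) -/
noncomputable def rowDegree {F : Type*} [Field F] {a b : ℕ} (Q : Matrix (Fin a) (Fin b) F[X])
    (i : Fin a) : ℕ :=
  Finset.univ.sup fun j => (Q i j).natDegree

/-! ## Minimal bases -/

/-- The `i`-th row of a matrix polynomial, as a vector over the field of rational functions. -/
noncomputable def ratRow {F : Type*} [Field F] {a b : ℕ} (Q : Matrix (Fin a) (Fin b) F[X])
    (i : Fin a) : Fin b → RatFunc F :=
  fun j => algebraMap F[X] (RatFunc F) (Q i j)

/-- The rows of `Q` form a minimal polynomial basis of the rational subspace that they span: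
they are linearly independent over `F(λ)`, and among all polynomial bases of that subspace theirs
has least order, the order being the sum of the degrees of the vectors. (All bases of the subspace
have the same number of elements, so they can all be arranged as matrices of the size of `Q`.) -/
def IsMinimalBasis {F : Type*} [Field F] {a b : ℕ} (Q : Matrix (Fin a) (Fin b) F[X]) : Prop :=
  LinearIndependent (RatFunc F) (ratRow Q) ∧
    ∀ R : Matrix (Fin a) (Fin b) F[X],
      LinearIndependent (RatFunc F) (ratRow R) →
      Submodule.span (RatFunc F) (Set.range (ratRow R)) =
        Submodule.span (RatFunc F) (Set.range (ratRow Q)) →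
      ∑ i, rowDegree Q i ≤ ∑ i, rowDegree R i

/-- Dual minimal bases. -/
structure IsDualMinimalBases {F : Type*} [Field F] {a b c : ℕ}
    (K : Matrix (Fin a) (Fin c) F[X]) (N : Matrix (Fin b) (Fin c) F[X]) : Prop where
  card_add : a + b = c
  mul_transpose : K * Nᵀ = 0
  left_minimal : IsMinimalBasis K
  right_minimal : IsMinimalBasis N

/-! ## The matrix equation -/

/-- The grade-`l` solutions `M` of the equation `N₂ M N₁ᵀ = P`. -/
def solutionSet {F : Type*} [Field F] {m n p q : ℕ} (N₁ : Matrix (Fin n) (Fin q) F[X])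
    (N₂ : Matrix (Fin m) (Fin p) F[X]) (P : Matrix (Fin m) (Fin n) F[X]) (l : ℕ) :
    Set (Matrix (Fin p) (Fin q) F[X]) :=
  {M | HasGrade M l ∧ N₂ * M * N₁ᵀ = P}

/-! ## Moore-Penrose pseudoinverse, convolution matrices, minimum norm solutions -/

/-- `G` is a Moore-Penrose inverse of `A`, with respect to the involution `star` of `F`
(complex conjugation on `ℂ`, the identity on `ℝ`). -/
structure IsMoorePenrose {F : Type*} [Field F] [StarRing F] {ι κ : Type*} [Fintype ι] [Fintype κ]
    (A : Matrix ι κ F) (G : Matrix κ ι F) : Prop where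
  mul_mul : A * G * A = A
  mul_mul' : G * A * G = G
  herm : (A * G)ᴴ = A * G
  herm' : (G * A)ᴴ = G * A

/-- The Moore-Penrose inverse is unique when it exists. -/
theorem IsMoorePenrose.unique {F : Type*} [Field F] [StarRing F] {ι κ : Type*} [Fintype ι]
    [Fintype κ] {A : Matrix ι κ F} {G H : Matrix κ ι F} (hG : IsMoorePenrose A G)
    (hH : IsMoorePenrose A H) : G = H := by
  have h1 : A * G = A * H := by
    have e1 : (A * H) * (A * G) = A * G := by
      rw [← Matrix.mul_assoc, hH.mul_mul]
    have e2 : (A * G) * (A * H) = A * H := by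
      rw [← Matrix.mul_assoc, hG.mul_mul]
    have e3 := congrArg Matrix.conjTranspose e1
    rw [Matrix.conjTranspose_mul, hG.herm, hH.herm, e2] at e3
    exact e3.symm
  have h2 : G * A = H * A := by
    have e1 : (G * A) * (H * A) = G * A := by
      rw [Matrix.mul_assoc, ← Matrix.mul_assoc A H A, hH.mul_mul]
    have e2 : (H * A) * (G * A) = H * A := by
      rw [Matrix.mul_assoc, ← Matrix.mul_assoc A G A, hG.mul_mul]
    have e3 := congrArg Matrix.conjTranspose e1
    rw [Matrix.conjTranspose_mul, hG.herm', hH.herm', e2] at e3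
    exact e3.symm
  calc G = G * A * G := hG.mul_mul'.symm
    _ = H * A * H := by rw [h2, Matrix.mul_assoc, h1, ← Matrix.mul_assoc]
    _ = H := hH.mul_mul'

open Classical in
/-- The Moore-Penrose pseudoinverse `A†` (zero if there is none). -/
noncomputable def pseudoinverse {F : Type*} [Field F] [StarRing F] {ι κ : Type*} [Fintype ι]
    [Fintype κ] (A : Matrix ι κ F) : Matrix κ ι F :=
  if h : ∃ G, IsMoorePenrose A G then h.choose else 0

/-- The convolution matrix `C_j(Q)` of a matrix polynomial `Q` of grade `q`. It has `q + j + 1`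
block rows and `j + 1` block columns, and its block in position `(r, s)` is the coefficient of
`λ ^ (q - (r - s))` of `Q` if `0 ≤ r - s ≤ q`, and zero otherwise. -/
def convMatrix {F : Type*} [Field F] {a b : ℕ} (Q : Matrix (Fin a) (Fin b) F[X]) (q j : ℕ) :
    Matrix (Fin (q + j + 1) × Fin a) (Fin (j + 1) × Fin b) F :=
  fun r s =>
    if (s.1 : ℕ) ≤ (r.1 : ℕ) ∧ (r.1 : ℕ) - (s.1 : ℕ) ≤ q then
      (Q r.2 s.2).coeff (q - ((r.1 : ℕ) - (s.1 : ℕ)))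
    else 0

/-- The block column `C_0(Q)` of the coefficients `Q_q, …, Q_1, Q_0` of a matrix polynomial `Q`
of grade `q`. -/
def coeffColumn {F : Type*} [Field F] {a b : ℕ} (Q : Matrix (Fin a) (Fin b) F[X]) (q : ℕ) :
    Matrix (Fin (q + 1) × Fin a) (Fin b) F :=
  fun r c => (Q r.2 c).coeff (q - (r.1 : ℕ))

theorem convMatrix_zero {F : Type*} [Field F] {a b : ℕ} (Q : Matrix (Fin a) (Fin b) F[X])
    (q : ℕ) (r : Fin (q + 1) × Fin a) (c : Fin b) :
    convMatrix Q q 0 r (0, c) = coeffColumn Q q r c := by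
  have h := r.1.isLt
  simp only [convMatrix, coeffColumn]
  rw [if_pos]
  · simp
  · simp; omega

/-- The matrix polynomial of grade `k` whose coefficients are the blocks of a block column,
in the order of decreasing powers: the inverse of `coeffColumn`. -/
noncomputable def ofCoeffColumn {F : Type*} [Field F] {a b k : ℕ}
    (B : Matrix (Fin (k + 1) × Fin a) (Fin b) F) : Matrix (Fin a) (Fin b) F[X] :=
  fun i c => ∑ r : Fin (k + 1), Polynomial.monomial (k - (r : ℕ)) (B (r, i) c)

/-- For `N` of grade `g` and `Q` of grade `g + k`, the matrix polynomial `Φ_N†[Q]` of grade `k`,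
that is, the minimum norm solution `B` to `N B = Q`: its coefficients are given by
`C_0(B) = C_k(N)† C_0(Q)`. -/
noncomputable def minNormSolution {F : Type*} [Field F] [StarRing F] {t c r : ℕ}
    (N : Matrix (Fin t) (Fin c) F[X]) (g k : ℕ) (Q : Matrix (Fin t) (Fin r) F[X]) :
    Matrix (Fin c) (Fin r) F[X] :=
  ofCoeffColumn (k := k) (pseudoinverse (convMatrix N g k) * coeffColumn Q (g + k))

/-- `Ψ†_{(N₁,N₂)}[P] = (Φ_{N₁}†[(Φ_{N₂}†[P])ᵀ])ᵀ`, where `N₁` and `N₂` have grades `e` and `h`,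
`P` has grade `l + e + h`, the inner minimum norm solution has grade `l + e` and the outer one
grade `l`. -/
noncomputable def minNormSolution₂ {F : Type*} [Field F] [StarRing F] {m n p q : ℕ}
    (N₁ : Matrix (Fin n) (Fin q) F[X]) (N₂ : Matrix (Fin m) (Fin p) F[X]) (e h l : ℕ)
    (P : Matrix (Fin m) (Fin n) F[X]) : Matrix (Fin p) (Fin q) F[X] :=
  (minNormSolution N₁ e l (minNormSolution N₂ h (l + e) P)ᵀ)ᵀ

/-!
Write `N₂ M N₁ᵀ = P` as two one-sided equations: `N₂ Z = P` for `Z` of grade `l + ε`, and then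
`N₁ Mᵀ = Zᵀ` for `M` of grade `l`. On coefficients, multiplication by `N` of grade `g` on matrix
polynomials of grade `k` is the convolution matrix `C_k(N)`. Two facts are needed: its kernel, and
that it has full row rank.

*Kernel.* Let `K`, `N` be dual minimal bases whose row degrees are `l` and `ε`. By dimension count
over the rational functions, a polynomial vector killed by `N` is a rational combination of the
rows of `K`. Exchanging a row of `K` for a nonzero vector of degree less than `l` in their rational
span would lower the order of the basis, so there is no such vector
(`IsMinimalBasis.eq_zero_of_degree_lt`). Applied to the remainders of a division by the common
denominator, this shows that the combination is polynomial (`IsMinimalBasis.exists_eq_vecMul`);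
applied to the leading coefficients, it shows that no leading terms cancel
(`IsMinimalBasis.degree_le_of_vecMul`). So the kernel of `N` in grade `l + t` consists of the
`Kᵀ X` with `X` of grade `t`, uniquely determined.

*Rank.* The kernel gives the rank of `C_{l+t}(N)`. As the rank is at most the number of rows, the
order of `K` is at most that of `N`; by symmetry the orders agree
(`IsDualMinimalBases.mul_rowDegree_eq`), and then the rank equals the number of rows
(`IsDualMinimalBases.exists_convMatrix_mul_eq_one`).

Hence right inverses of `C_{l+ε}(N₂)` and `C_l(N₁)` solve the two equations, with freedom `K₂ᵀ X`
in `Z` and `K₁ᵀ Y` in `Mᵀ`. This is the parametrization of all solutions (`bijOn_solutionSet`),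
valid for arbitrary right inverses, so over any field. A Moore-Penrose inverse of a matrix of full
row rank is a right inverse, and for an anisotropic involution `Aᴴ (A Aᴴ)⁻¹` is one.
-/


/-! ### Minimal bases whose row degrees are all equal -/

theorem ratRow_updateRow {F : Type*} [Field F] {a c : ℕ} (K : Matrix (Fin a) (Fin c) F[X])
    (i₀ : Fin a) (v : Fin c → F[X]) :
    ratRow (K.updateRow i₀ v) =
      Function.update (ratRow K) i₀ (fun j => algebraMap F[X] (RatFunc F) (v j)) := by
  funext i j
  by_cases h : i = i₀
  · subst h; simp [ratRow]
  · simp [ratRow, h]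

theorem rowDegree_updateRow_of_ne {F : Type*} [Field F] {a c : ℕ}
    (K : Matrix (Fin a) (Fin c) F[X]) {i i₀ : Fin a} (h : i ≠ i₀) (v : Fin c → F[X]) :
    rowDegree (K.updateRow i₀ v) i = rowDegree K i := by
  simp [rowDegree, h]

theorem vecMul_injective_of_ratRow {F : Type*} [Field F] {a c : ℕ}
    {K : Matrix (Fin a) (Fin c) F[X]} (hK : LinearIndependent (RatFunc F) (ratRow K))
    {r : Fin a → F[X]} (h : r ᵥ* K = 0) : r = 0 := by
  funext i
  have := Fintype.linearIndependent_iff.1 hK (fun i => algebraMap F[X] (RatFunc F) (r i)) ?_ i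
  · simpa using this
  · funext j
    have h' := congrArg (algebraMap F[X] (RatFunc F)) (congrFun h j)
    simpa [Matrix.vecMul, dotProduct, ratRow, Finset.sum_apply, Algebra.smul_def] using h'

/-- Replacing a row of a basis by a vector of the spanned subspace whose coordinate at that row
does not vanish gives a basis of the same subspace. -/
theorem linearIndependent_update_and_span_eq {𝕜 V ι : Type*} [Field 𝕜] [AddCommGroup V]
    [Module 𝕜 V] [Fintype ι] [DecidableEq ι] {b : ι → V} (hb : LinearIndependent 𝕜 b) {x : ι → 𝕜}
    {i₀ : ι} (hx : x i₀ ≠ 0) {w : V} (hw : w = ∑ i, x i • b i) :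
    LinearIndependent 𝕜 (Function.update b i₀ w) ∧
      Submodule.span 𝕜 (Set.range (Function.update b i₀ w)) =
        Submodule.span 𝕜 (Set.range b) := by
  have hspan : Submodule.span 𝕜 (Set.range (Function.update b i₀ w)) =
      Submodule.span 𝕜 (Set.range b) := by
    apply le_antisymm
    · rw [Submodule.span_le]
      rintro _ ⟨i, rfl⟩
      by_cases h : i = i₀
      · subst h
        rw [Function.update_self, hw]
        exact Submodule.sum_mem _ fun i _ =>
          Submodule.smul_mem _ _ (Submodule.subset_span ⟨i, rfl⟩)
      · rw [Function.update_of_ne h]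
        exact Submodule.subset_span ⟨i, rfl⟩
    · rw [Submodule.span_le]
      have hne : ∀ i, i ≠ i₀ →
          b i ∈ Submodule.span 𝕜 (Set.range (Function.update b i₀ w)) := fun i h =>
        Submodule.subset_span ⟨i, Function.update_of_ne h _ _⟩
      rintro _ ⟨i, rfl⟩
      by_cases h : i = i₀
      · subst h
        have e : x i • b i = w - ∑ j ∈ Finset.univ.erase i, x j • b j := by
          rw [hw, ← Finset.add_sum_erase _ _ (Finset.mem_univ i)]; abel
        rw [SetLike.mem_coe, ← Submodule.smul_mem_iff _ hx, e]
        refine Submodule.sub_mem _ (Submodule.subset_span ⟨i, Function.update_self ..⟩) ?_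
        exact Submodule.sum_mem _ fun j hj =>
          Submodule.smul_mem _ _ (hne j (Finset.ne_of_mem_erase hj))
      · exact hne i h
  refine ⟨?_, hspan⟩
  rw [linearIndependent_iff_card_eq_finrank_span] at hb ⊢
  rw [hb, Set.finrank, Set.finrank, hspan]

/-- A nonzero polynomial vector in the rational row space of a minimal basis with row degrees `l`
has degree at least `l`: otherwise it could replace one of the rows, lowering the order. -/
theorem IsMinimalBasis.eq_zero_of_degree_lt {F : Type*} [Field F] {a c l : ℕ}
    {K : Matrix (Fin a) (Fin c) F[X]} (hK : IsMinimalBasis K) (hl : ∀ i, rowDegree K i = l)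
    {q : F[X]} (hq : q ≠ 0) {v : Fin c → F[X]} {r : Fin a → F[X]} (h : q • v = r ᵥ* K)
    (hv : ∀ j, (v j).degree < (l : WithBot ℕ)) : r = 0 := by
  rcases Nat.eq_zero_or_pos l with rfl | hl0
  · apply vecMul_injective_of_ratRow hK.1
    rw [← h]
    funext j
    have := hv j
    rw [Nat.cast_zero, ← not_le, Polynomial.zero_le_degree_iff, not_not] at this
    simp [this]
  by_contra hr
  obtain ⟨i₀, hi₀⟩ := Function.ne_iff.1 hr
  have hq' : algebraMap F[X] (RatFunc F) q ≠ 0 := by simpa using hq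
  set x : Fin a → RatFunc F :=
    fun i => algebraMap F[X] (RatFunc F) (r i) / algebraMap F[X] (RatFunc F) q with hxdef
  have hx : x i₀ ≠ 0 := div_ne_zero (by simpa using hi₀) hq'
  have hw : (fun j => algebraMap F[X] (RatFunc F) (v j)) = ∑ i, x i • ratRow K i := by
    funext j
    have h' := congrArg (algebraMap F[X] (RatFunc F)) (congrFun h j)
    simp only [Pi.smul_apply, smul_eq_mul, map_mul, Matrix.vecMul, dotProduct, map_sum] at h'
    apply mul_left_cancel₀ hq'
    rw [h', Finset.sum_apply, Finset.mul_sum]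
    refine Finset.sum_congr rfl fun i _ => ?_
    simp only [hxdef, Pi.smul_apply, smul_eq_mul, ratRow]
    field_simp
  obtain ⟨h1, h2⟩ := linearIndependent_update_and_span_eq hK.1 hx hw
  rw [← ratRow_updateRow] at h1 h2
  have hle := hK.2 _ h1 h2
  refine absurd hle (not_le.2 (Finset.sum_lt_sum (fun i _ => ?_) ⟨i₀, Finset.mem_univ _, ?_⟩))
  all_goals
    have hlt : rowDegree (K.updateRow i₀ v) i₀ < l := by
      rw [rowDegree, Finset.sup_lt_iff hl0]
      intro j _
      rw [Matrix.updateRow_self]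
      by_cases h0 : v j = 0
      · simpa [h0] using hl0
      · exact (Polynomial.natDegree_lt_iff_degree_lt h0).2 (hv j)
  · by_cases h : i = i₀
    · subst h; rw [hl]; exact hlt.le
    · rw [rowDegree_updateRow_of_ne _ h]
  · rw [hl]; exact hlt

theorem hasGrade_of_rowDegree_eq {F : Type*} [Field F] {a c l : ℕ}
    {K : Matrix (Fin a) (Fin c) F[X]} (hl : ∀ i, rowDegree K i = l) : HasGrade K l := by
  intro i j
  refine Polynomial.degree_le_of_natDegree_le ?_
  rw [← hl i]
  exact Finset.le_sup (f := fun j => (K i j).natDegree) (Finset.mem_univ j)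

theorem HasGrade.coeff_eq_zero {F : Type*} [Field F] {a c k s : ℕ}
    {K : Matrix (Fin a) (Fin c) F[X]} (h : HasGrade K k) (hs : k < s) (i : Fin a) (j : Fin c) :
    (K i j).coeff s = 0 :=
  Polynomial.coeff_eq_zero_of_degree_lt ((h i j).trans_lt (by exact_mod_cast hs))

theorem hasGrade_iff_coeff {F : Type*} [Field F] {a c k : ℕ}
    {K : Matrix (Fin a) (Fin c) F[X]} :
    HasGrade K k ↔ ∀ s, k < s → ∀ i j, (K i j).coeff s = 0 :=
  ⟨fun h _ hs i j => h.coeff_eq_zero hs i j, fun h i j =>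
    (Polynomial.degree_le_iff_coeff_zero _ _).2 fun s hs => h s (by exact_mod_cast hs) i j⟩

/-- A polynomial vector in the rational row space of a minimal basis with equal row degrees is a
polynomial combination of the rows: dividing the numerators of its coordinates by their common
denominator, the remainders represent a vector of too low degree. -/
theorem IsMinimalBasis.exists_eq_vecMul {F : Type*} [Field F] {a c l : ℕ}
    {K : Matrix (Fin a) (Fin c) F[X]} (hK : IsMinimalBasis K) (hl : ∀ i, rowDegree K i = l)
    {q : F[X]} (hq : q ≠ 0) {v : Fin c → F[X]} {r : Fin a → F[X]} (h : q • v = r ᵥ* K) :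
    ∃ s : Fin a → F[X], v = s ᵥ* K := by
  set s : Fin a → F[X] := fun i => r i / q
  set t : Fin a → F[X] := fun i => r i % q
  have hr : r = q • s + t := by
    funext i; exact (EuclideanDomain.div_add_mod (r i) q).symm
  have e : q • (v - s ᵥ* K) = t ᵥ* K := by
    rw [smul_sub, h, hr, Matrix.add_vecMul, Matrix.smul_vecMul]; abel
  have ht : t = 0 := by
    refine hK.eq_zero_of_degree_lt hl hq e fun j => ?_
    have hj := congrArg Polynomial.degree (congrFun e j)
    rw [Pi.smul_apply, smul_eq_mul, Polynomial.degree_mul] at hj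
    have hlt : ((t ᵥ* K) j).degree < q.degree + (l : WithBot ℕ) := by
      refine (Polynomial.degree_sum_le Finset.univ fun i => t i * K i j).trans_lt ?_
      have hbot : (⊥ : WithBot ℕ) < q.degree + (l : WithBot ℕ) := by
        rw [Polynomial.degree_eq_natDegree hq]; exact_mod_cast WithBot.bot_lt_coe _
      rw [Finset.sup_lt_iff hbot]
      intro i _
      rw [Polynomial.degree_mul]
      by_cases h0 : K i j = 0
      · simpa [h0] using hbot
      · exact WithBot.add_lt_add_of_lt_of_le (by simpa using h0)
          (EuclideanDomain.mod_lt (r i) hq) (hasGrade_of_rowDegree_eq hl i j)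
    rw [← hj] at hlt
    exact lt_of_add_lt_add_left hlt
  refine ⟨s, ?_⟩
  rw [ht, Matrix.zero_vecMul, smul_eq_zero] at e
  exact sub_eq_zero.1 (e.resolve_left hq)

/-- The predictable degree property of a minimal basis with row degrees `l`: a combination of
degree at most `l + t` of the rows has coefficients of degree at most `t`, since the leading
coefficient matrix has independent rows. -/
theorem IsMinimalBasis.degree_le_of_vecMul {F : Type*} [Field F] {a c l t : ℕ}
    {K : Matrix (Fin a) (Fin c) F[X]} (hK : IsMinimalBasis K) (hl : ∀ i, rowDegree K i = l)
    {s : Fin a → F[X]} (hs : ∀ j, ((s ᵥ* K) j).degree ≤ ((l + t : ℕ) : WithBot ℕ)) (i : Fin a) :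
    (s i).degree ≤ (t : WithBot ℕ) := by
  set e := Finset.univ.sup fun i => (s i).natDegree with he
  have hse : ∀ i, (s i).natDegree ≤ e := fun i =>
    Finset.le_sup (f := fun i => (s i).natDegree) (Finset.mem_univ i)
  refine Polynomial.degree_le_of_natDegree_le ((hse i).trans ?_)
  by_contra! hte
  have hKl := hasGrade_of_rowDegree_eq hl
  have hα : (fun i => Polynomial.C ((s i).coeff e)) = 0 := by
    refine hK.eq_zero_of_degree_lt hl one_ne_zero (one_smul _ _) fun j => ?_
    rw [Polynomial.degree_lt_iff_coeff_zero]
    intro k hk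
    simp only [Matrix.vecMul, dotProduct, Polynomial.finsetSum_coeff, Polynomial.coeff_C_mul]
    rcases hk.eq_or_lt with rfl | hk
    · have h0 : ((s ᵥ* K) j).coeff (e + l) = 0 :=
        Polynomial.coeff_eq_zero_of_degree_lt ((hs j).trans_lt (by norm_cast; omega))
      rw [← h0]
      simp only [Matrix.vecMul, dotProduct, Polynomial.finsetSum_coeff]
      refine Finset.sum_congr rfl fun i _ => ?_
      exact (Polynomial.coeff_mul_add_eq_of_natDegree_le (hse i)
        (Polynomial.natDegree_le_of_degree_le (hKl i j))).symm
    · exact Finset.sum_eq_zero fun i _ => by rw [hKl.coeff_eq_zero hk, mul_zero]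
  -- the maximum of the degrees is positive, so it is attained by a nonzero coefficient
  obtain ⟨i₁, -, hi₁⟩ := Finset.exists_mem_eq_sup Finset.univ ⟨i, Finset.mem_univ i⟩
    fun i => (s i).natDegree
  have h1 := congrFun hα i₁
  simp only [Pi.zero_apply, Polynomial.C_eq_zero] at h1
  rw [he, hi₁, ← Polynomial.leadingCoeff, Polynomial.leadingCoeff_eq_zero] at h1
  rw [he, hi₁, h1, Polynomial.natDegree_zero] at hte
  omega

theorem IsDualMinimalBases.symm {F : Type*} [Field F] {a b c : ℕ}
    {K : Matrix (Fin a) (Fin c) F[X]} {N : Matrix (Fin b) (Fin c) F[X]}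
    (h : IsDualMinimalBases K N) : IsDualMinimalBases N K where
  card_add := by rw [add_comm, h.card_add]
  mul_transpose := by
    rw [← Matrix.transpose_transpose N, ← Matrix.transpose_mul, h.mul_transpose,
      Matrix.transpose_zero]
  left_minimal := h.right_minimal
  right_minimal := h.left_minimal

/-- The rational kernel of `N` is the rational row space of its dual `K`, by dimension count;
stated with cleared denominators. -/
theorem IsDualMinimalBases.exists_smul_eq_vecMul {F : Type*} [Field F] {a b c : ℕ}
    {K : Matrix (Fin a) (Fin c) F[X]} {N : Matrix (Fin b) (Fin c) F[X]}
    (h : IsDualMinimalBases K N) {v : Fin c → F[X]} (hv : N *ᵥ v = 0) :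
    ∃ q : F[X], q ≠ 0 ∧ ∃ r : Fin a → F[X], q • v = r ᵥ* K := by
  let f := algebraMap F[X] (RatFunc F)
  let N' : Matrix (Fin b) (Fin c) (RatFunc F) := N.map f
  have hrank : Module.finrank (RatFunc F) (LinearMap.range N'.mulVecLin) = b := by
    have : LinearIndependent (RatFunc F) N'.row := h.right_minimal.1
    simpa [Matrix.rank] using this.rank_matrix
  have hker : Module.finrank (RatFunc F) (LinearMap.ker N'.mulVecLin) = a := by
    have := N'.mulVecLin.finrank_range_add_finrank_ker
    rw [hrank, Module.finrank_fin_fun] at this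
    have := h.card_add
    omega
  have hle : Submodule.span (RatFunc F) (Set.range (ratRow K)) ≤
      LinearMap.ker N'.mulVecLin := by
    rw [Submodule.span_le]
    rintro _ ⟨i, rfl⟩
    have h0 := congrFun₂ h.mul_transpose i
    simp only [SetLike.mem_coe, LinearMap.mem_ker, Matrix.mulVecLin_apply]
    funext k
    have := congrArg f (h0 k)
    simp only [Matrix.mul_apply, Matrix.transpose_apply, map_sum, map_mul, Matrix.zero_apply,
      map_zero] at this
    refine Eq.trans ?_ this
    simp [Matrix.mulVec, dotProduct, N', ratRow, f, mul_comm]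
  have heq := Submodule.eq_of_le_of_finrank_eq hle (by
    rw [finrank_span_eq_card h.left_minimal.1, hker, Fintype.card_fin])
  have hmem : (fun j => f (v j)) ∈ Submodule.span (RatFunc F) (Set.range (ratRow K)) := by
    rw [heq, LinearMap.mem_ker]
    funext k
    have := congrArg f (congrFun hv k)
    simpa [Matrix.mulVec, dotProduct, N'] using this
  obtain ⟨x, hx⟩ := (Submodule.mem_span_range_iff_exists_fun _).1 hmem
  obtain ⟨q, hq⟩ := IsLocalization.exist_integer_multiples_of_finite (nonZeroDivisors F[X]) x
  choose r hr using hq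
  refine ⟨q, nonZeroDivisors.coe_ne_zero q, r, ?_⟩
  funext j
  apply RatFunc.algebraMap_injective F
  have hj := congrFun hx j
  simp only [Finset.sum_apply, Pi.smul_apply, smul_eq_mul, ratRow] at hj
  simp only [Pi.smul_apply, smul_eq_mul, map_mul, Matrix.vecMul, dotProduct, map_sum]
  change _ * f (v j) = _
  rw [← hj, Finset.mul_sum]
  refine Finset.sum_congr rfl fun i _ => ?_
  rw [hr, Algebra.smul_def]
  ring

/-- The polynomial kernel of `N` in degrees at most `l + t`. -/
theorem IsDualMinimalBases.exists_eq_transpose_mul {F : Type*} [Field F] {a b c l t r : ℕ}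
    {K : Matrix (Fin a) (Fin c) F[X]} {N : Matrix (Fin b) (Fin c) F[X]}
    (h : IsDualMinimalBases K N) (hl : ∀ i, rowDegree K i = l)
    {B : Matrix (Fin c) (Fin r) F[X]} (hB : HasGrade B (l + t)) (hNB : N * B = 0) :
    ∃ X : Matrix (Fin a) (Fin r) F[X], HasGrade X t ∧ B = Kᵀ * X := by
  have hcol : ∀ k : Fin r, ∃ s : Fin a → F[X],
      (∀ i, (s i).degree ≤ (t : WithBot ℕ)) ∧ Bᵀ k = s ᵥ* K := by
    intro k
    have hv : N *ᵥ Bᵀ k = 0 := by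
      funext i; exact congrFun₂ hNB i k
    obtain ⟨q, hq, x, hx⟩ := h.exists_smul_eq_vecMul hv
    obtain ⟨s, hs⟩ := h.left_minimal.exists_eq_vecMul hl hq hx
    exact ⟨s, h.left_minimal.degree_le_of_vecMul hl fun j => hs ▸ hB j k, hs⟩
  choose s hs1 hs2 using hcol
  refine ⟨Matrix.of fun i k => s k i, fun i k => hs1 k i, ?_⟩
  ext1 j k
  refine (congrFun (hs2 k) j).trans ?_
  simp [Matrix.vecMul, dotProduct, Matrix.mul_apply, mul_comm]

theorem IsMinimalBasis.eq_zero_of_transpose_mul {F : Type*} [Field F] {a c r : ℕ}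
    {K : Matrix (Fin a) (Fin c) F[X]} (hK : IsMinimalBasis K) {X : Matrix (Fin a) (Fin r) F[X]}
    (h : Kᵀ * X = 0) : X = 0 := by
  have hcol : ∀ k, Xᵀ k = 0 := fun k => vecMul_injective_of_ratRow hK.1 <| by
    funext j
    simpa [Matrix.vecMul, dotProduct, Matrix.mul_apply, mul_comm] using congrFun₂ h j k
  ext1 i k
  exact congrFun (hcol k) i

/-! ### Grades and degrees of products -/

theorem degree_mul_apply_lt {F : Type*} [Field F] {a b c s t : ℕ}
    {A : Matrix (Fin a) (Fin b) F[X]} {B : Matrix (Fin b) (Fin c) F[X]} (hA : HasGrade A s)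
    (hB : ∀ i j, (B i j).degree < (t : WithBot ℕ)) (i : Fin a) (j : Fin c) :
    ((A * B) i j).degree < ((s + t : ℕ) : WithBot ℕ) := by
  refine (Polynomial.degree_sum_le Finset.univ fun k => A i k * B k j).trans_lt ?_
  rw [Finset.sup_lt_iff (WithBot.bot_lt_coe _)]
  intro k _
  by_cases h0 : B k j = 0
  · rw [h0, mul_zero, Polynomial.degree_zero]
    exact WithBot.bot_lt_coe (s + t)
  rw [Polynomial.degree_mul, Nat.cast_add]
  exact (add_le_add_left (hA i k) _).trans_lt
    (WithBot.add_lt_add_left (WithBot.natCast_ne_bot s) (hB k j))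

theorem HasGrade.mul {F : Type*} [Field F] {a b c s t : ℕ}
    {A : Matrix (Fin a) (Fin b) F[X]} {B : Matrix (Fin b) (Fin c) F[X]} (hA : HasGrade A s)
    (hB : HasGrade B t) : HasGrade (A * B) (s + t) := by
  intro i j
  refine (Polynomial.degree_sum_le Finset.univ fun k => A i k * B k j).trans ?_
  refine Finset.sup_le fun k _ => ?_
  exact (Polynomial.degree_mul_le_of_le (hA i k) (hB k j)).trans (by simp)

theorem HasGrade.transpose {F : Type*} [Field F] {a b k : ℕ}
    {A : Matrix (Fin a) (Fin b) F[X]} (h : HasGrade A k) : HasGrade Aᵀ k := fun i j => h j i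

theorem HasGrade.add {F : Type*} [Field F] {a b k : ℕ}
    {A B : Matrix (Fin a) (Fin b) F[X]} (hA : HasGrade A k) (hB : HasGrade B k) :
    HasGrade (A + B) k := fun i j =>
  Polynomial.degree_add_le_of_degree_le (hA i j) (hB i j)

theorem HasGrade.sub {F : Type*} [Field F] {a b k : ℕ}
    {A B : Matrix (Fin a) (Fin b) F[X]} (hA : HasGrade A k) (hB : HasGrade B k) :
    HasGrade (A - B) k := fun i j =>
  (Polynomial.degree_sub_le _ _).trans (max_le (hA i j) (hB i j))

theorem hasGrade_zero_iff {F : Type*} [Field F] {a b : ℕ} {A : Matrix (Fin a) (Fin b) F[X]} :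
    HasGrade A 0 ↔ ∃ Y : Matrix (Fin a) (Fin b) F, A = Y.map Polynomial.C := by
  constructor
  · intro h
    refine ⟨A.map fun p => p.coeff 0, ?_⟩
    ext1 i j
    exact Polynomial.eq_C_of_degree_le_zero (h i j)
  · rintro ⟨Y, rfl⟩ i j
    exact Polynomial.degree_C_le

theorem HasGrade.matDegree_le {F : Type*} [Field F] {a b k : ℕ}
    {A : Matrix (Fin a) (Fin b) F[X]} (h : HasGrade A k) : matDegree A ≤ k :=
  Finset.sup_le fun _ _ => h _ _

/-! ### Coefficient columns and convolution matrices -/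

theorem coeff_ofCoeffColumn {F : Type*} [Field F] {a b k : ℕ}
    (B : Matrix (Fin (k + 1) × Fin a) (Fin b) F) (i : Fin a) (j : Fin b) (s : ℕ) :
    (ofCoeffColumn B i j).coeff s =
      if h : s ≤ k then B (⟨k - s, by omega⟩, i) j else 0 := by
  simp only [ofCoeffColumn, Polynomial.finsetSum_coeff, Polynomial.coeff_monomial]
  split_ifs with h
  · rw [Finset.sum_eq_single ⟨k - s, by omega⟩]
    · rw [if_pos (by simp only; omega)]
    · intro r _ hr
      rw [if_neg]
      intro h'
      apply hr
      ext
      simp only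
      omega
    · simp
  · exact Finset.sum_eq_zero fun r _ => if_neg (by omega)

theorem hasGrade_ofCoeffColumn {F : Type*} [Field F] {a b k : ℕ}
    (B : Matrix (Fin (k + 1) × Fin a) (Fin b) F) : HasGrade (ofCoeffColumn B) k :=
  hasGrade_iff_coeff.2 fun s hs i j => by rw [coeff_ofCoeffColumn, dif_neg (by omega)]

theorem coeffColumn_ofCoeffColumn {F : Type*} [Field F] {a b k : ℕ}
    (B : Matrix (Fin (k + 1) × Fin a) (Fin b) F) : coeffColumn (ofCoeffColumn B) k = B := by
  ext ⟨r, i⟩ j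
  have := r.isLt
  rw [coeffColumn, coeff_ofCoeffColumn, dif_pos (by omega)]
  congr 2
  ext
  simp only
  omega

theorem ofCoeffColumn_coeffColumn {F : Type*} [Field F] {a b k : ℕ}
    {A : Matrix (Fin a) (Fin b) F[X]} (h : HasGrade A k) :
    ofCoeffColumn (coeffColumn A k) = A := by
  ext i j s
  rw [coeff_ofCoeffColumn]
  split_ifs with hs
  · simp only [coeffColumn]
    congr 1
    omega
  · rw [h.coeff_eq_zero (by omega)]

/-- The convolution matrix represents multiplication by `N` on the coefficients. -/
theorem coeffColumn_mul_ofCoeffColumn {F : Type*} [Field F] {a b c g k : ℕ}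
    {N : Matrix (Fin a) (Fin b) F[X]} (hN : HasGrade N g)
    (B : Matrix (Fin (k + 1) × Fin b) (Fin c) F) :
    coeffColumn (N * ofCoeffColumn B) (g + k) = convMatrix N g k * B := by
  ext ⟨r, i⟩ j
  have hr := r.isLt
  simp only [coeffColumn, Matrix.mul_apply, ofCoeffColumn, Polynomial.finsetSum_coeff,
    Finset.mul_sum, Fintype.sum_prod_type]
  rw [Finset.sum_comm]
  refine Finset.sum_congr rfl fun s _ => Finset.sum_congr rfl fun x _ => ?_
  have hs := s.isLt
  simp only [convMatrix]
  rw [← Polynomial.C_mul_X_pow_eq_monomial, mul_left_comm, Polynomial.coeff_C_mul,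
    Polynomial.coeff_mul_X_pow', mul_comm]
  congr 1
  -- for `r < s`, where the block is zero, the coefficient of `N` is that of a power above `g`
  by_cases h1 : (s : ℕ) ≤ r
  · by_cases h2 : (r : ℕ) - s ≤ g
    · rw [if_pos (by omega), if_pos ⟨h1, h2⟩]
      congr 1
      omega
    · rw [if_neg (by omega), if_neg (by tauto)]
  · rw [if_pos (by omega), if_neg (by tauto)]
    exact hN.coeff_eq_zero (by omega) _ _

theorem coeffColumn_mul {F : Type*} [Field F] {a b c g k : ℕ}
    {N : Matrix (Fin a) (Fin b) F[X]} (hN : HasGrade N g) {B : Matrix (Fin b) (Fin c) F[X]}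
    (hB : HasGrade B k) :
    coeffColumn (N * B) (g + k) = convMatrix N g k * coeffColumn B k := by
  rw [← coeffColumn_mul_ofCoeffColumn hN, ofCoeffColumn_coeffColumn hB]

/-! ### The convolution matrices of dual minimal bases have full row rank -/

theorem IsDualMinimalBases.exists_eq_convMatrix_mulVec {F : Type*} [Field F]
    {a b c l ε t : ℕ} {K : Matrix (Fin a) (Fin c) F[X]} {N : Matrix (Fin b) (Fin c) F[X]}
    (h : IsDualMinimalBases K N) (hl : ∀ i, rowDegree K i = l) (hε : ∀ i, rowDegree N i = ε)
    {v : Fin (l + t + 1) × Fin c → F} (hv : convMatrix N ε (l + t) *ᵥ v = 0) :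
    ∃ x : Fin (t + 1) × Fin a → F, v = convMatrix Kᵀ l t *ᵥ x := by
  have hN := hasGrade_of_rowDegree_eq hε
  have hK := (hasGrade_of_rowDegree_eq hl).transpose
  set B : Matrix (Fin (l + t + 1) × Fin c) (Fin 1) F := Matrix.replicateCol (Fin 1) v with hBdef
  have hB := hasGrade_ofCoeffColumn B
  have h0 : N * ofCoeffColumn B = 0 := by
    rw [← ofCoeffColumn_coeffColumn (hN.mul hB), coeffColumn_mul_ofCoeffColumn hN, hBdef,
      ← Matrix.replicateCol_mulVec, hv]
    ext1 i j
    simp [ofCoeffColumn]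
  obtain ⟨X, hX, hBX⟩ := h.exists_eq_transpose_mul hl hB h0
  refine ⟨fun p => coeffColumn X t p 0, ?_⟩
  have e := congrArg (fun A => coeffColumn A (l + t)) hBX
  simp only [coeffColumn_ofCoeffColumn, coeffColumn_mul hK hX] at e
  funext p
  exact congrFun₂ e p 0

theorem IsMinimalBasis.convMatrix_transpose_mulVec_injective {F : Type*} [Field F] {a c l t : ℕ}
    {K : Matrix (Fin a) (Fin c) F[X]} (h : IsMinimalBasis K) (hl : ∀ i, rowDegree K i = l) :
    Function.Injective (convMatrix Kᵀ l t).mulVecLin := by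
  have hK := (hasGrade_of_rowDegree_eq hl).transpose
  rw [← LinearMap.ker_eq_bot, LinearMap.ker_eq_bot']
  intro x hx
  rw [Matrix.mulVecLin_apply] at hx
  set B : Matrix (Fin (t + 1) × Fin a) (Fin 1) F := Matrix.replicateCol (Fin 1) x with hBdef
  have h0 : Kᵀ * ofCoeffColumn B = 0 := by
    rw [← ofCoeffColumn_coeffColumn (hK.mul (hasGrade_ofCoeffColumn B)),
      coeffColumn_mul_ofCoeffColumn hK, hBdef, ← Matrix.replicateCol_mulVec, hx]
    ext1 i j
    simp [ofCoeffColumn]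
  have hB : B = 0 := by
    rw [← coeffColumn_ofCoeffColumn B, h.eq_zero_of_transpose_mul h0]
    ext; simp [coeffColumn]
  funext p
  exact congrFun₂ hB p 0

/-- The rank of the convolution matrix of `N`, from its kernel. -/
theorem IsDualMinimalBases.finrank_range_convMatrix {F : Type*} [Field F] {a b c l ε : ℕ}
    {K : Matrix (Fin a) (Fin c) F[X]} {N : Matrix (Fin b) (Fin c) F[X]}
    (h : IsDualMinimalBases K N) (hl : ∀ i, rowDegree K i = l) (hε : ∀ i, rowDegree N i = ε)
    (t : ℕ) :
    Module.finrank F (LinearMap.range (convMatrix N ε (l + t)).mulVecLin) =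
      l * a + (l + t + 1) * b := by
  have hker : LinearMap.ker (convMatrix N ε (l + t)).mulVecLin =
      LinearMap.range (convMatrix Kᵀ l t).mulVecLin := by
    apply le_antisymm
    · intro v hv
      obtain ⟨x, hx⟩ := h.exists_eq_convMatrix_mulVec hl hε hv
      exact ⟨x, hx.symm⟩
    · rintro _ ⟨x, rfl⟩
      have hN := hasGrade_of_rowDegree_eq hε
      have hK := (hasGrade_of_rowDegree_eq hl).transpose
      have e : convMatrix N ε (l + t) * (convMatrix Kᵀ l t * Matrix.replicateCol (Fin 1) x) =
          0 := by
        rw [← coeffColumn_mul_ofCoeffColumn hK, ← coeffColumn_mul hN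
          (hK.mul (hasGrade_ofCoeffColumn _)), ← Matrix.mul_assoc, h.symm.mul_transpose]
        ext; simp [coeffColumn]
      rw [← Matrix.replicateCol_mulVec, ← Matrix.replicateCol_mulVec] at e
      funext p
      exact congrFun₂ e p 0
  have h1 := (convMatrix N ε (l + t)).mulVecLin.finrank_range_add_finrank_ker
  rw [hker, LinearMap.finrank_range_of_inj
    (h.left_minimal.convMatrix_transpose_mulVec_injective hl)] at h1
  simp only [Module.finrank_fintype_fun_eq_card, Fintype.card_prod, Fintype.card_fin] at h1
  have hc : (l + t + 1) * c = (l + t + 1) * a + (l + t + 1) * b := by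
    rw [← mul_add, h.card_add]
  linarith

theorem IsDualMinimalBases.mul_rowDegree_le {F : Type*} [Field F] {a b c l ε : ℕ}
    {K : Matrix (Fin a) (Fin c) F[X]} {N : Matrix (Fin b) (Fin c) F[X]}
    (h : IsDualMinimalBases K N) (hl : ∀ i, rowDegree K i = l) (hε : ∀ i, rowDegree N i = ε) :
    l * a ≤ ε * b := by
  have h1 := Submodule.finrank_le (LinearMap.range (convMatrix N ε (l + 0)).mulVecLin)
  rw [h.finrank_range_convMatrix hl hε] at h1
  simp only [Module.finrank_fintype_fun_eq_card, Fintype.card_prod, Fintype.card_fin] at h1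
  linarith

/-- Dual minimal bases have the same order. As the rank of a convolution matrix is at most its
number of rows, one order is at most the other, and the roles can be exchanged. -/
theorem IsDualMinimalBases.mul_rowDegree_eq {F : Type*} [Field F] {a b c l ε : ℕ}
    {K : Matrix (Fin a) (Fin c) F[X]} {N : Matrix (Fin b) (Fin c) F[X]}
    (h : IsDualMinimalBases K N) (hl : ∀ i, rowDegree K i = l) (hε : ∀ i, rowDegree N i = ε) :
    l * a = ε * b :=
  le_antisymm (h.mul_rowDegree_le hl hε) (h.symm.mul_rowDegree_le hε hl)

theorem IsDualMinimalBases.exists_convMatrix_mul_eq_one {F : Type*} [Field F] {a b c l ε : ℕ}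
    {K : Matrix (Fin a) (Fin c) F[X]} {N : Matrix (Fin b) (Fin c) F[X]}
    (h : IsDualMinimalBases K N) (hl : ∀ i, rowDegree K i = l) (hε : ∀ i, rowDegree N i = ε)
    (t : ℕ) : ∃ G : Matrix (Fin (l + t + 1) × Fin c) (Fin (ε + (l + t) + 1) × Fin b) F,
      convMatrix N ε (l + t) * G = 1 := by
  rw [← Matrix.mulVec_surjective_iff_exists_right_inverse]
  have : Function.Surjective (convMatrix N ε (l + t)).mulVecLin := by
    rw [← LinearMap.range_eq_top]
    apply Submodule.eq_top_of_finrank_eq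
    rw [h.finrank_range_convMatrix hl hε, h.mul_rowDegree_eq hl hε]
    simp only [Module.finrank_fintype_fun_eq_card, Fintype.card_prod, Fintype.card_fin]
    ring
  exact this

/-! ### Moore-Penrose inverses of matrices of full row rank -/

theorem IsMoorePenrose.mul_eq_one {F : Type*} [Field F] [StarRing F] {ι κ : Type*} [Fintype ι]
    [DecidableEq ι] [Fintype κ] {A : Matrix ι κ F} {G H : Matrix κ ι F}
    (hG : IsMoorePenrose A G) (hH : A * H = 1) : A * G = 1 := by
  rw [← Matrix.mul_one (A * G), ← hH, ← Matrix.mul_assoc, hG.mul_mul]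

theorem isMoorePenrose_pseudoinverse {F : Type*} [Field F] [StarRing F] {ι κ : Type*} [Fintype ι]
    [Fintype κ] {A : Matrix ι κ F} (h : ∃ G, IsMoorePenrose A G) :
    IsMoorePenrose A (pseudoinverse A) := by
  rw [pseudoinverse, dif_pos h]
  exact h.choose_spec

/-- If the involution is anisotropic, a matrix `A` with a right inverse has the Moore-Penrose
inverse `Aᴴ (A Aᴴ)⁻¹`. -/
theorem exists_isMoorePenrose_of_anisotropic {F : Type*} [Field F] [StarRing F]
    (hF : ∀ (k : ℕ) (v : Fin k → F), star v ⬝ᵥ v = 0 → v = 0) {ι κ : Type*} [Fintype ι]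
    [DecidableEq ι] [Fintype κ] {A : Matrix ι κ F} {H : Matrix κ ι F} (hH : A * H = 1) :
    ∃ G, IsMoorePenrose A G := by
  have hF' : ∀ v : κ → F, star v ⬝ᵥ v = 0 → v = 0 := by
    intro v hv
    have e := Fintype.equivFin κ
    have h0 := hF _ (v ∘ e.symm) (by
      rw [← hv]
      exact Fintype.sum_equiv e.symm _ _ fun _ => rfl)
    funext i
    simpa using congrFun h0 (e i)
  have hinj : Function.Injective (A * Aᴴ).mulVec := by
    rw [← Matrix.coe_mulVecLin, ← LinearMap.ker_eq_bot, LinearMap.ker_eq_bot']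
    intro w hw
    rw [Matrix.mulVecLin_apply] at hw
    have h1 : Aᴴ *ᵥ w = 0 := by
      apply hF'
      rw [Matrix.star_mulVec, Matrix.conjTranspose_conjTranspose, ← Matrix.dotProduct_mulVec,
        Matrix.mulVec_mulVec, hw, dotProduct_zero]
    have h2 : Hᴴ * Aᴴ = 1 := by
      rw [← Matrix.conjTranspose_mul, hH, Matrix.conjTranspose_one]
    rw [← Matrix.one_mulVec w, ← h2, ← Matrix.mulVec_mulVec, h1, Matrix.mulVec_zero]
  have hu : IsUnit (A * Aᴴ).det :=
    (Matrix.isUnit_iff_isUnit_det _).1 (Matrix.mulVec_injective_iff_isUnit.1 hinj)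
  have hG : A * (Aᴴ * (A * Aᴴ)⁻¹) = 1 := by
    rw [← Matrix.mul_assoc, Matrix.mul_nonsing_inv _ hu]
  refine ⟨Aᴴ * (A * Aᴴ)⁻¹, ?_, ?_, ?_, ?_⟩
  · rw [hG, Matrix.one_mul]
  · rw [Matrix.mul_assoc, hG, Matrix.mul_one]
  · rw [hG, Matrix.conjTranspose_one]
  · simp only [Matrix.conjTranspose_mul, Matrix.conjTranspose_nonsing_inv,
      Matrix.conjTranspose_conjTranspose, Matrix.mul_assoc]

/-! ### Solving the equation with right inverses of the convolution matrices -/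

/-- The matrix polynomial of grade `k` whose coefficients are obtained by applying `G` to the
coefficients of `Q`, as a linear map in `Q`. If `G` is a right inverse of `convMatrix N g k`, it
solves the equation `N B = Q`; the pseudoinverse gives `minNormSolution`. -/
noncomputable def rightInvSolution {F : Type*} [Field F] {g k t c : ℕ}
    (G : Matrix (Fin (k + 1) × Fin c) (Fin (g + k + 1) × Fin t) F) (r : ℕ) :
    Matrix (Fin t) (Fin r) F[X] →ₗ[F] Matrix (Fin c) (Fin r) F[X] where
  toFun Q := ofCoeffColumn (G * coeffColumn Q (g + k))
  map_add' Q R := by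
    have e : coeffColumn (Q + R) (g + k) = coeffColumn Q (g + k) + coeffColumn R (g + k) := by
      ext; simp [coeffColumn]
    rw [e, Matrix.mul_add]
    ext1 i j
    simp [ofCoeffColumn, Finset.sum_add_distrib]
  map_smul' x Q := by
    have e : coeffColumn (x • Q) (g + k) = x • coeffColumn Q (g + k) := by
      ext; simp [coeffColumn]
    rw [e, Matrix.mul_smul]
    ext1 i j
    simp [ofCoeffColumn, Finset.smul_sum, Polynomial.smul_monomial]

theorem hasGrade_rightInvSolution {F : Type*} [Field F] {g k t c r : ℕ}
    (G : Matrix (Fin (k + 1) × Fin c) (Fin (g + k + 1) × Fin t) F)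
    (Q : Matrix (Fin t) (Fin r) F[X]) : HasGrade (rightInvSolution G r Q) k :=
  hasGrade_ofCoeffColumn _

theorem mul_rightInvSolution {F : Type*} [Field F] {g k t c r : ℕ}
    {N : Matrix (Fin t) (Fin c) F[X]} (hN : HasGrade N g)
    {G : Matrix (Fin (k + 1) × Fin c) (Fin (g + k + 1) × Fin t) F} (hG : convMatrix N g k * G = 1)
    {Q : Matrix (Fin t) (Fin r) F[X]} (hQ : HasGrade Q (g + k)) :
    N * rightInvSolution G r Q = Q := by
  rw [← ofCoeffColumn_coeffColumn (hN.mul (hasGrade_rightInvSolution G Q)),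
    coeffColumn_mul hN (hasGrade_rightInvSolution G Q)]
  simp only [rightInvSolution, LinearMap.coe_mk, AddHom.coe_mk, coeffColumn_ofCoeffColumn]
  rw [← Matrix.mul_assoc, hG, Matrix.one_mul, ofCoeffColumn_coeffColumn hQ]

/-- The linear part of the parametrization of the solutions of `N₂ M N₁ᵀ = P`, with the
polynomial parameter of grade `ε` given by its coefficients. -/
noncomputable def solutionParam {F : Type*} [Field F] {m n m₁ m₂ l ε : ℕ}
    (K₁ : Matrix (Fin m₁) (Fin (n + m₁)) F[X]) (K₂ : Matrix (Fin m₂) (Fin (m + m₂)) F[X])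
    (G₁ : Matrix (Fin (l + 1) × Fin (n + m₁)) (Fin (ε + l + 1) × Fin n) F) :
    Matrix (Fin (ε + 1) × Fin m₂) (Fin n) F × Matrix (Fin m₁) (Fin (m + m₂)) F →ₗ[F]
      Matrix (Fin (m + m₂)) (Fin (n + m₁)) F[X] where
  toFun XY := (rightInvSolution G₁ _ ((ofCoeffColumn XY.1)ᵀ * K₂))ᵀ +
    (XY.2.map Polynomial.C)ᵀ * K₁
  map_add' U V := by
    have e1 : ofCoeffColumn (U + V).1 = ofCoeffColumn U.1 + ofCoeffColumn V.1 := by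
      ext1 i j; simp [ofCoeffColumn, Finset.sum_add_distrib]
    have e2 : (U + V).2.map Polynomial.C = U.2.map Polynomial.C + V.2.map Polynomial.C := by
      ext1 i j; simp
    rw [e1, e2]
    simp only [Matrix.transpose_add, Matrix.add_mul, map_add]
    abel
  map_smul' x U := by
    have e1 : ofCoeffColumn (x • U).1 = x • ofCoeffColumn U.1 := by
      ext1 i j; simp [ofCoeffColumn, Finset.smul_sum, Polynomial.smul_monomial]
    have e2 : (x • U).2.map Polynomial.C = x • U.2.map Polynomial.C := by
      ext1 i j; simp [Polynomial.smul_C]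
    rw [e1, e2]
    simp only [Matrix.transpose_smul, Matrix.smul_mul, map_smul, smul_add, RingHom.id_apply]

/-- The parametrization of the solutions, for any right inverses of the two convolution matrices:
`N₂ Z = P` is solved for `Z = M N₁ᵀ` first, which leaves the freedom `K₂ᵀ X`, then
`N₁ Mᵀ = Zᵀ` for `M`, which leaves the freedom `K₁ᵀ Y`. -/
theorem bijOn_solutionSet {F : Type*} [Field F] {m n m₁ m₂ l ε η : ℕ}
    {K₁ : Matrix (Fin m₁) (Fin (n + m₁)) F[X]} {N₁ : Matrix (Fin n) (Fin (n + m₁)) F[X]}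
    {K₂ : Matrix (Fin m₂) (Fin (m + m₂)) F[X]} {N₂ : Matrix (Fin m) (Fin (m + m₂)) F[X]}
    (h₁ : IsDualMinimalBases K₁ N₁) (h₂ : IsDualMinimalBases K₂ N₂)
    (hK₁ : ∀ i, rowDegree K₁ i = l) (hK₂ : ∀ i, rowDegree K₂ i = l)
    (hN₁ : ∀ i, rowDegree N₁ i = ε) (hN₂ : ∀ i, rowDegree N₂ i = η)
    {P : Matrix (Fin m) (Fin n) F[X]} (hP : HasGrade P (η + (l + ε)))
    {G₁ : Matrix (Fin (l + 1) × Fin (n + m₁)) (Fin (ε + l + 1) × Fin n) F}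
    {G₂ : Matrix (Fin (l + ε + 1) × Fin (m + m₂)) (Fin (η + (l + ε) + 1) × Fin m) F}
    (hG₁ : convMatrix N₁ ε l * G₁ = 1) (hG₂ : convMatrix N₂ η (l + ε) * G₂ = 1) :
    Set.BijOn
      (fun XY : Matrix (Fin m₂) (Fin n) F[X] × Matrix (Fin m₁) (Fin (m + m₂)) F =>
        (rightInvSolution G₁ _ (rightInvSolution G₂ _ P)ᵀ)ᵀ +
          (rightInvSolution G₁ _ (XY.1ᵀ * K₂))ᵀ + (XY.2.map Polynomial.C)ᵀ * K₁)
      {XY | HasGrade XY.1 ε} (solutionSet N₁ N₂ P l) := by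
  have gN₁ := hasGrade_of_rowDegree_eq hN₁
  have gN₂ := hasGrade_of_rowDegree_eq hN₂
  have gK₁ := hasGrade_of_rowDegree_eq hK₁
  have gK₂ := hasGrade_of_rowDegree_eq hK₂
  set Z₀ := rightInvSolution G₂ n P with hZ₀
  have gZ₀ : HasGrade Z₀ (l + ε) := hasGrade_rightInvSolution G₂ P
  have eN₁K₁ : K₁ * N₁ᵀ = 0 := h₁.mul_transpose
  have eN₂K₂ : N₂ * K₂ᵀ = 0 := h₂.symm.mul_transpose
  -- multiplication of the parametrized solution by `N₁ᵀ` gives the solution of the first step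
  have key : ∀ XY : Matrix (Fin m₂) (Fin n) F[X] × Matrix (Fin m₁) (Fin (m + m₂)) F,
      HasGrade XY.1 ε →
      ((rightInvSolution G₁ _ Z₀ᵀ)ᵀ + (rightInvSolution G₁ _ (XY.1ᵀ * K₂))ᵀ +
        (XY.2.map Polynomial.C)ᵀ * K₁) * N₁ᵀ = Z₀ + K₂ᵀ * XY.1 := by
    intro XY hX
    have e1 : N₁ * rightInvSolution G₁ _ Z₀ᵀ = Z₀ᵀ :=
      mul_rightInvSolution gN₁ hG₁ (by rw [add_comm ε l]; exact gZ₀.transpose)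
    have e2 : N₁ * rightInvSolution G₁ _ (XY.1ᵀ * K₂) = XY.1ᵀ * K₂ :=
      mul_rightInvSolution gN₁ hG₁ (hX.transpose.mul gK₂)
    rw [Matrix.add_mul, Matrix.add_mul, Matrix.mul_assoc, eN₁K₁, Matrix.mul_zero, add_zero,
      ← Matrix.transpose_mul, ← Matrix.transpose_mul, e1, e2, Matrix.transpose_mul,
      Matrix.transpose_transpose, Matrix.transpose_transpose]
  have gC : ∀ Y : Matrix (Fin m₁) (Fin (m + m₂)) F, HasGrade ((Y.map Polynomial.C)ᵀ * K₁) l := by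
    intro Y
    rw [← zero_add l]
    exact (hasGrade_zero_iff.2 ⟨Y, rfl⟩).transpose.mul gK₁
  have gM : ∀ XY : Matrix (Fin m₂) (Fin n) F[X] × Matrix (Fin m₁) (Fin (m + m₂)) F,
      HasGrade ((rightInvSolution G₁ _ Z₀ᵀ)ᵀ + (rightInvSolution G₁ _ (XY.1ᵀ * K₂))ᵀ +
        (XY.2.map Polynomial.C)ᵀ * K₁) l := fun XY =>
    (((hasGrade_rightInvSolution G₁ _).transpose).add
      (hasGrade_rightInvSolution G₁ _).transpose).add (gC XY.2)
  refine ⟨?_, ?_, ?_⟩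
  · intro XY hX
    refine ⟨gM XY, ?_⟩
    rw [Matrix.mul_assoc, key XY hX, Matrix.mul_add, mul_rightInvSolution gN₂ hG₂ hP,
      ← Matrix.mul_assoc, eN₂K₂, Matrix.zero_mul, add_zero]
  · rintro ⟨X, Y⟩ hX ⟨X', Y'⟩ hX' h
    have e : X = X' := by
      have h' := congrArg (· * N₁ᵀ) h
      simp only [key _ hX, key _ hX'] at h'
      have h'' : K₂ᵀ * (X - X') = 0 := by
        rw [Matrix.mul_sub, add_left_cancel h', sub_self]
      exact sub_eq_zero.1 (h₂.left_minimal.eq_zero_of_transpose_mul h'')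
    subst e
    have h' := congrArg Matrix.transpose (add_left_cancel h)
    simp only [Matrix.transpose_mul, Matrix.transpose_transpose] at h'
    have h'' : K₁ᵀ * (Y.map Polynomial.C - Y'.map Polynomial.C) = 0 := by
      rw [Matrix.mul_sub, h', sub_self]
    have h3 := sub_eq_zero.1 (h₁.left_minimal.eq_zero_of_transpose_mul h'')
    rw [Matrix.map_injective Polynomial.C_injective h3]
  · rintro M ⟨gM', hM⟩
    obtain ⟨X, hX, eX⟩ := h₂.exists_eq_transpose_mul hK₂ (t := ε) (B := M * N₁ᵀ - Z₀)
      ((gM'.mul gN₁.transpose).sub gZ₀) (by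
        rw [Matrix.mul_sub, ← Matrix.mul_assoc, hM, mul_rightInvSolution gN₂ hG₂ hP, sub_self])
    have hM0 := key (X, 0) hX
    have gM0 := gM (X, 0)
    set M₀ := (rightInvSolution G₁ _ Z₀ᵀ)ᵀ + (rightInvSolution G₁ _ (X.transpose * K₂))ᵀ +
      ((0 : Matrix (Fin m₁) (Fin (m + m₂)) F).map Polynomial.C)ᵀ * K₁ with hM₀
    obtain ⟨Y, hY, eY⟩ := h₁.exists_eq_transpose_mul hK₁ (t := 0) (B := (M - M₀)ᵀ)
      (gM'.sub gM0).transpose (by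
        rw [← Matrix.transpose_transpose N₁, ← Matrix.transpose_mul, Matrix.sub_mul, hM0,
          ← eX, add_sub_cancel, sub_self, Matrix.transpose_zero])
    obtain ⟨Y', rfl⟩ := hasGrade_zero_iff.1 hY
    refine ⟨(X, Y'), hX, ?_⟩
    have eM := congrArg Matrix.transpose eY
    rw [Matrix.transpose_transpose, Matrix.transpose_mul, Matrix.transpose_transpose,
      sub_eq_iff_eq_add'] at eM
    rw [eM, hM₀]
    simp

/-! ### Structure of the solution set -/

theorem solutionParam_apply {F : Type*} [Field F] {m n m₁ m₂ l ε : ℕ}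
    (K₁ : Matrix (Fin m₁) (Fin (n + m₁)) F[X]) (K₂ : Matrix (Fin m₂) (Fin (m + m₂)) F[X])
    (G₁ : Matrix (Fin (l + 1) × Fin (n + m₁)) (Fin (ε + l + 1) × Fin n) F)
    (U : Matrix (Fin (ε + 1) × Fin m₂) (Fin n) F × Matrix (Fin m₁) (Fin (m + m₂)) F) :
    solutionParam K₁ K₂ G₁ U = (rightInvSolution G₁ _ ((ofCoeffColumn U.1)ᵀ * K₂))ᵀ +
      (U.2.map Polynomial.C)ᵀ * K₁ := rfl

/-- The solution set is a translate of the range of an injective linear map. -/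
theorem exists_solutionSet_eq_range {F : Type*} [Field F] {m n m₁ m₂ l ε η : ℕ}
    {K₁ : Matrix (Fin m₁) (Fin (n + m₁)) F[X]} {N₁ : Matrix (Fin n) (Fin (n + m₁)) F[X]}
    {K₂ : Matrix (Fin m₂) (Fin (m + m₂)) F[X]} {N₂ : Matrix (Fin m) (Fin (m + m₂)) F[X]}
    (h₁ : IsDualMinimalBases K₁ N₁) (h₂ : IsDualMinimalBases K₂ N₂)
    (hK₁ : ∀ i, rowDegree K₁ i = l) (hK₂ : ∀ i, rowDegree K₂ i = l)
    (hN₁ : ∀ i, rowDegree N₁ i = ε) (hN₂ : ∀ i, rowDegree N₂ i = η)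
    {P : Matrix (Fin m) (Fin n) F[X]} (hP : HasGrade P (η + (l + ε))) :
    ∃ (M₀ : Matrix (Fin (m + m₂)) (Fin (n + m₁)) F[X])
      (T : Matrix (Fin (ε + 1) × Fin m₂) (Fin n) F × Matrix (Fin m₁) (Fin (m + m₂)) F →ₗ[F]
        Matrix (Fin (m + m₂)) (Fin (n + m₁)) F[X]),
      Function.Injective T ∧ solutionSet N₁ N₂ P l = Set.range fun U => M₀ + T U := by
  obtain ⟨G₁, hG₁⟩ := h₁.exists_convMatrix_mul_eq_one hK₁ hN₁ 0
  obtain ⟨G₂, hG₂⟩ := h₂.exists_convMatrix_mul_eq_one hK₂ hN₂ ε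
  have hbij := bijOn_solutionSet h₁ h₂ hK₁ hK₂ hN₁ hN₂ hP (G₁ := G₁) hG₁ hG₂
  refine ⟨(rightInvSolution G₁ _ (rightInvSolution G₂ _ P)ᵀ)ᵀ, solutionParam K₁ K₂ G₁, ?_, ?_⟩
  · intro U V h
    have h' : (ofCoeffColumn U.1, U.2) = (ofCoeffColumn V.1, V.2) := by
      refine hbij.injOn (hasGrade_ofCoeffColumn U.1) (hasGrade_ofCoeffColumn V.1) ?_
      simp only [add_assoc]
      rw [← solutionParam_apply, ← solutionParam_apply, h]
    rw [Prod.mk.injEq] at h'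
    refine Prod.ext ?_ h'.2
    rw [← coeffColumn_ofCoeffColumn U.1, h'.1, coeffColumn_ofCoeffColumn]
  · rw [← hbij.image_eq]
    ext M
    constructor
    · rintro ⟨⟨X, Y⟩, hX, rfl⟩
      refine ⟨(coeffColumn X ε, Y), ?_⟩
      simp only [solutionParam_apply, ofCoeffColumn_coeffColumn hX, add_assoc]
    · rintro ⟨U, rfl⟩
      refine ⟨(ofCoeffColumn U.1, U.2), hasGrade_ofCoeffColumn U.1, ?_⟩
      simp only [solutionParam_apply, add_assoc]

theorem matDegree_eq_of_mem_solutionSet {F : Type*} [Field F] {m n p q l ε η : ℕ}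
    {N₁ : Matrix (Fin n) (Fin q) F[X]} {N₂ : Matrix (Fin m) (Fin p) F[X]}
    (hN₁ : HasGrade N₁ ε) (hN₂ : HasGrade N₂ η) {P : Matrix (Fin m) (Fin n) F[X]}
    (hP : matDegree P = ((η + (ε + l) : ℕ) : WithBot ℕ)) {M : Matrix (Fin p) (Fin q) F[X]}
    (hM : M ∈ solutionSet N₁ N₂ P l) : matDegree M = l := by
  refine hM.1.matDegree_le.eq_of_not_lt fun hlt => hP.not_lt ?_
  have hlt' : ∀ i j, (Mᵀ i j).degree < (l : WithBot ℕ) := fun i j =>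
    (Finset.le_sup (f := fun p : Fin _ × Fin _ => (M p.1 p.2).degree)
      (Finset.mem_univ (j, i))).trans_lt hlt
  have h1 := degree_mul_apply_lt hN₁ hlt'
  rw [matDegree, Finset.sup_lt_iff (WithBot.bot_lt_coe _)]
  rintro ⟨i, j⟩ -
  rw [← hM.2, Matrix.mul_assoc]
  refine degree_mul_apply_lt hN₂ (fun i j => ?_) i j
  have := h1 j i
  rwa [← Matrix.transpose_apply (N₁ * Mᵀ), Matrix.transpose_mul,
    Matrix.transpose_transpose] at this

theorem mainTheorem3 {F : Type*} [Field F] {m n m₁ m₂ d l ε η : ℕ}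
    (hm : 0 < m) (hn : 0 < n) (hl : l < d)
    (K₁ : Matrix (Fin m₁) (Fin (n + m₁)) F[X]) (N₁ : Matrix (Fin n) (Fin (n + m₁)) F[X])
    (K₂ : Matrix (Fin m₂) (Fin (m + m₂)) F[X]) (N₂ : Matrix (Fin m) (Fin (m + m₂)) F[X])
    (h₁ : IsDualMinimalBases K₁ N₁) (h₂ : IsDualMinimalBases K₂ N₂)
    (hK₁ : ∀ i, rowDegree K₁ i = l) (hK₂ : ∀ i, rowDegree K₂ i = l)
    (hN₁ : ∀ i, rowDegree N₁ i = ε) (hN₂ : ∀ i, rowDegree N₂ i = η)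
    (hεη : ε + η = d - l)
    (P : Matrix (Fin m) (Fin n) F[X]) (hP : HasGrade P d) :
    -- (a) solvability, infinitely many solutions, degree of the solutions
    ((solutionSet N₁ N₂ P l).Nonempty ∧
      (Infinite F → (solutionSet N₁ N₂ P l).Infinite) ∧
      (matDegree P = d → ∀ M ∈ solutionSet N₁ N₂ P l, matDegree M = l)) ∧
    -- (b) the solution set is an affine space of the given dimension
    (∃ S : AffineSubspace F (Matrix (Fin (m + m₂)) (Fin (n + m₁)) F[X]),
      (S : Set (Matrix (Fin (m + m₂)) (Fin (n + m₁)) F[X])) = solutionSet N₁ N₂ P l ∧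
      FiniteDimensional F S.direction ∧
      Module.finrank F S.direction = m₂ * n * (ε + 1) + (m₂ + m) * m₁) ∧
    -- (c) for every involution of `F` with respect to which the pseudoinverses exist, which is so
    -- for every anisotropic one (in particular over `ℝ` and over `ℂ`): the parametrization
    (∀ [StarRing F],
      ((∀ (k : ℕ) (v : Fin k → F), star v ⬝ᵥ v = 0 → v = 0) →
        (∃ G, IsMoorePenrose (convMatrix N₁ ε l) G) ∧
        (∃ G, IsMoorePenrose (convMatrix N₂ η (l + ε)) G)) ∧
      ((∃ G, IsMoorePenrose (convMatrix N₁ ε l) G) →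
        (∃ G, IsMoorePenrose (convMatrix N₂ η (l + ε)) G) →
        Set.BijOn
          (fun XY : Matrix (Fin m₂) (Fin n) F[X] × Matrix (Fin m₁) (Fin (m + m₂)) F =>
            minNormSolution₂ N₁ N₂ ε η l P + (minNormSolution N₁ ε l (XY.1ᵀ * K₂))ᵀ +
              (XY.2.map Polynomial.C)ᵀ * K₁)
          {XY | HasGrade XY.1 ε} (solutionSet N₁ N₂ P l))) := by

  have hd : d = η + (l + ε) := by omega
  subst hd
  have gN₁ := hasGrade_of_rowDegree_eq hN₁
  have gN₂ := hasGrade_of_rowDegree_eq hN₂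
  obtain ⟨M₀, T, hT, hS⟩ := exists_solutionSet_eq_range h₁ h₂ hK₁ hK₂ hN₁ hN₂ hP
  have hdim : Module.finrank F
      (Matrix (Fin (ε + 1) × Fin m₂) (Fin n) F × Matrix (Fin m₁) (Fin (m + m₂)) F) =
      m₂ * n * (ε + 1) + (m₂ + m) * m₁ := by
    rw [Module.finrank_prod, Module.finrank_matrix, Module.finrank_matrix, Module.finrank_self]
    simp only [Fintype.card_prod, Fintype.card_fin]
    ring
  -- without rows of `K₁` and `K₂`, the dual bases have degree zero, which `l < d` excludes
  have hpos : 0 < m₁ ∨ 0 < m₂ := by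
    by_contra! h0
    have e1 := h₁.mul_rowDegree_eq hK₁ hN₁
    have e2 := h₂.mul_rowDegree_eq hK₂ hN₂
    rw [Nat.le_zero.1 h0.1, mul_zero, eq_comm, mul_eq_zero] at e1
    rw [Nat.le_zero.1 h0.2, mul_zero, eq_comm, mul_eq_zero] at e2
    omega
  refine ⟨⟨?_, ?_, ?_⟩, ?_, ?_⟩
  · rw [hS]
    exact Set.range_nonempty _
  · intro _
    have hpos' : 0 < Module.finrank F
        (Matrix (Fin (ε + 1) × Fin m₂) (Fin n) F × Matrix (Fin m₁) (Fin (m + m₂)) F) := by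
      rw [hdim]
      rcases hpos with h | h
      · exact Nat.add_pos_right _ (by positivity)
      · exact Nat.add_pos_left (by positivity) _
    have : Nontrivial
        (Matrix (Fin (ε + 1) × Fin m₂) (Fin n) F × Matrix (Fin m₁) (Fin (m + m₂)) F) :=
      Module.nontrivial_of_finrank_pos hpos'
    obtain ⟨w, hw⟩ := exists_ne
      (0 : Matrix (Fin (ε + 1) × Fin m₂) (Fin n) F × Matrix (Fin m₁) (Fin (m + m₂)) F)
    have : Infinite
        (Matrix (Fin (ε + 1) × Fin m₂) (Fin n) F × Matrix (Fin m₁) (Fin (m + m₂)) F) :=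
      Infinite.of_injective (fun x : F => x • w) (smul_left_injective F hw)
    rw [hS]
    exact Set.infinite_range_of_injective ((add_right_injective M₀).comp hT)
  · intro hdeg M hM
    refine matDegree_eq_of_mem_solutionSet gN₁ gN₂ (hdeg.trans ?_) hM
    rw [add_comm ε l]
  · refine ⟨AffineSubspace.mk' M₀ (LinearMap.range T), ?_, ?_, ?_⟩
    · rw [hS]
      ext M
      simp only [SetLike.mem_coe, AffineSubspace.mem_mk', vsub_eq_sub, LinearMap.mem_range,
        Set.mem_range, eq_sub_iff_add_eq']
    · rw [AffineSubspace.direction_mk']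
      infer_instance
    · rw [AffineSubspace.direction_mk', LinearMap.finrank_range_of_inj hT, hdim]
  · intro _
    obtain ⟨H₁, hH₁⟩ := h₁.exists_convMatrix_mul_eq_one hK₁ hN₁ 0
    obtain ⟨H₂, hH₂⟩ := h₂.exists_convMatrix_mul_eq_one hK₂ hN₂ ε
    refine ⟨fun hF => ⟨exists_isMoorePenrose_of_anisotropic hF (H := H₁) hH₁,
      exists_isMoorePenrose_of_anisotropic hF hH₂⟩, fun hG₁ hG₂ => ?_⟩
    exact bijOn_solutionSet h₁ h₂ hK₁ hK₂ hN₁ hN₂ hP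
      ((isMoorePenrose_pseudoinverse hG₁).mul_eq_one (H := H₁) hH₁)
      ((isMoorePenrose_pseudoinverse hG₂).mul_eq_one hH₂)
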